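/- **Proposition.** Let $L$ be a finite-dimensional Lie algebra over a field $\mathbb F$ (of arbitrary characteristic), let $U(L)$ be its universal enveloping algebra, into which $L$ is embedded by the canonical map and which is a Lie algebra under $[u,v]=uv-vu$, and let $M$ be an abelian ideal of $L$. For a subspace $S\subseteq L$ and a two-sided ideal $\mathfrak a$ of $U(L)$ write $S\mathfrak a$ for the linear span in $U(L)$ of all products $xa$ with $x\in S$, $a\in\mathfrak a$. Let $\mathfrak m$ be a two-sided ideal of $U(L)$ with $U(L)/\mathfrak m\cong\mathbb F$ (as $\mathbb F$-algebras) and $MU(L)\subseteq\mathfrak m$. Then $MU(L)$ and $M\mathfrak m$ are two-sided ideals of $U(L)$; put $\widetilde I=MU(L)/M\mathfrak m$, considered as an abelian Lie algebra. Let $\omega(L)$ be the augmentation ideal of $U(L)$, i.e. the kernel of the algebra homomorphism $U(L)\to\mathbb F$ that maps $L$ to $0$, and let $C_L(M)$ be the centralizer of $M$ in $L$. 1. There is a unique well-defined homomorphism of Lie algebras $\beta:U(L)/MU(L)\to\mathfrak{gl}(\widetilde I)$ with $$\beta(w+MU(L))(a+M\mathfrak m)=[w,a]+M\mathfrak m\qquad(w\in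 U(L),\ a\in MU(L)).$$ 2. There is a unique Lie ideal $J$ of $U(L)$ that contains $MU(L)$ and satisfies $J/MU(L)=\ker\beta$. Put $\widetilde K=U(L)/J$, a Lie algebra that acts on $\widetilde I$ through $\beta$. Then the Lie algebra $\widetilde L=\widetilde I\rtimes_\beta\widetilde K$ is finite-dimensional. If $L/M$ is abelian, then $\widetilde L$ is metabelian, i.e. $\widetilde L''=0$. 3. $\mathfrak J=J\cap\mathfrak m$ is a two-sided associative ideal of $U(L)$, and it has codimension one in $J$. Moreover, $U(L)/\mathfrak J$ is finite-dimensional and $\dim U(L)/\mathfrak J=\dim U(L)/J+1$. 4. If $\mathfrak m=\omega(L)$, then $L\cap J=C_L(M)$ and $C_L(M)U(L)\subseteq\mathfrak J$. 5. If $\mathfrak m=\omega(L)$, then $$\widetilde\chi:M\rtimes L/C_L(M)\to\widetilde L,\qquad (a,\,x+C_L(M))\mapsto(a+M\mathfrak m,\,x+J)$$ is a well-defined injective homomorphism of Lie algebras, where $L/C_L(M)$ acts on $M$ by the adjoint action. It is an isomorphism if and only if $\dim L/C_L(M)=\dim\widetilde K$. -/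

import Mathlib

attribute [local instance] LieRing.ofAssociativeRing

/-- The universal enveloping algebra `U(L)`, regarded as a Lie algebra through `⁅u, v⁆ = uv - vu`. -/
abbrev UEA (F : Type*) (L : Type*) [Field F] [LieRing L] [LieAlgebra F L] :=
  UniversalEnvelopingAlgebra F L

/-! ### Quotients of Lie algebras and semidirect sums with an abelian ideal -/

section General

variable {F A B V : Type*} [Field F] [LieRing A] [LieAlgebra F A] [LieRing B] [LieAlgebra F B]
  [LieRing V] [LieAlgebra F V]

/-- The projection `A → A / I` as a homomorphism of Lie algebras. -/
def quotMk (I : LieIdeal F A) : A →ₗ⁅F⁆ A ⧸ I where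
  __ := I.toSubmodule.mkQ
  map_lie' := rfl

/-- A homomorphism of Lie algebras that vanishes on `I` factors through `A / I`. -/
def quotLift (I : LieIdeal F A) (f : A →ₗ⁅F⁆ B) (h : I ≤ f.ker) : (A ⧸ I) →ₗ⁅F⁆ B where
  __ := I.toSubmodule.liftQ (f : A →ₗ[F] B) (fun _ hx => LieHom.mem_ker.mp (h hx))
  map_lie' := by
    intro x y
    induction x using Submodule.Quotient.induction_on
    induction y using Submodule.Quotient.induction_on
    exact LieHom.map_lie f _ _

/-- Every linear endomorphism of an abelian Lie algebra is a derivation. -/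
def derOfEnd [IsLieAbelian V] : Module.End F V →ₗ⁅F⁆ LieDerivation F V V where
  toFun f :=
    { toLinearMap := f
      leibniz' := fun a b => by simp [trivial_lie_zero] }
  map_add' _ _ := rfl
  map_smul' _ _ := rfl
  map_lie' := rfl

end General

section LTilde

variable {F L : Type*} [Field F] [LieRing L] [LieAlgebra F L]

/-- The augmentation ideal `ω(L)`: the kernel of the algebra homomorphism `U(L) → F` that maps
every element of `L` to zero. -/
def augIdeal (F L : Type*) [Field F] [LieRing L] [LieAlgebra F L] : Ideal (UEA F L) :=
  RingHom.ker (UniversalEnvelopingAlgebra.lift F (0 : L →ₗ⁅F⁆ F))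

/-- The linear span `M𝔞` of all products `xa` with `x ∈ M` and `a ∈ 𝔞`, in `U(L)`. -/
def mulSpan (M : LieIdeal F L) (𝔞 : Ideal (UEA F L)) : Submodule F (UEA F L) :=
  M.toSubmodule.map (UniversalEnvelopingAlgebra.ι F : L →ₗ⁅F⁆ UEA F L).toLinearMap *
    𝔞.restrictScalars F

theorem adjoin_range_ι :
    Algebra.adjoin F (Set.range (UniversalEnvelopingAlgebra.ι F : L → UEA F L)) = ⊤ := by
  set S := Algebra.adjoin F (Set.range (UniversalEnvelopingAlgebra.ι F : L → UEA F L)) with hS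
  let f : L →ₗ⁅F⁆ S :=
    { toFun := fun x => ⟨UniversalEnvelopingAlgebra.ι F x, Algebra.subset_adjoin ⟨x, rfl⟩⟩
      map_add' := fun x y => Subtype.ext (by simp only [map_add]; rfl)
      map_smul' := fun c x => Subtype.ext (by simp only [map_smul]; rfl)
      map_lie' := fun {x y} => Subtype.ext (by
        simp only [LieHom.map_lie, LieRing.of_associative_ring_bracket]; rfl) }
  have h : S.val.comp (UniversalEnvelopingAlgebra.lift F f) = AlgHom.id F (UEA F L) := by
    apply UniversalEnvelopingAlgebra.hom_ext
    ext x
    change ((UniversalEnvelopingAlgebra.lift F f (UniversalEnvelopingAlgebra.ι F x) : S) :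
      UEA F L) = UniversalEnvelopingAlgebra.ι F x
    rw [UniversalEnvelopingAlgebra.lift_ι_apply]
    rfl
  rw [eq_top_iff]
  intro u _
  have := congrArg (fun g => g u) h
  simp only [AlgHom.comp_apply, AlgHom.id_apply] at this
  rw [← this]
  exact (UniversalEnvelopingAlgebra.lift F f u).2

theorem mul_mem_mulSpan_left (M : LieIdeal F L) (𝔞 : Ideal (UEA F L)) (u : UEA F L)
    {v : UEA F L} (hv : v ∈ mulSpan M 𝔞) : u * v ∈ mulSpan M 𝔞 := by
  have hu : u ∈ Algebra.adjoin F (Set.range (UniversalEnvelopingAlgebra.ι F : L → UEA F L)) := by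
    rw [adjoin_range_ι]; trivial
  induction hu using Algebra.adjoin_induction generalizing v with
  | mem u hu =>
    obtain ⟨y, rfl⟩ := hu
    refine Submodule.mul_induction_on hv ?_ ?_
    · rintro _ ⟨x, hx, rfl⟩ a ha
      change UniversalEnvelopingAlgebra.ι F y * (UniversalEnvelopingAlgebra.ι F x * a) ∈ _
      have e : UniversalEnvelopingAlgebra.ι F y * (UniversalEnvelopingAlgebra.ι F x * a) =
          UniversalEnvelopingAlgebra.ι F ⁅y, x⁆ * a +
          UniversalEnvelopingAlgebra.ι F x * (UniversalEnvelopingAlgebra.ι F y * a) := by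
        rw [LieHom.map_lie, LieRing.of_associative_ring_bracket]; noncomm_ring
      rw [e]
      exact add_mem
        (Submodule.mul_mem_mul (Submodule.mem_map_of_mem (LieSubmodule.lie_mem M hx)) ha)
        (Submodule.mul_mem_mul (Submodule.mem_map_of_mem hx) (𝔞.mul_mem_left _ ha))
    · intro x y hx hy; rw [mul_add]; exact add_mem hx hy
  | algebraMap r => rw [← Algebra.smul_def]; exact Submodule.smul_mem _ r hv
  | add x y _ _ hx hy => rw [add_mul]; exact add_mem (hx hv) (hy hv)
  | mul x y _ _ hx hy => rw [mul_assoc]; exact hx (hy hv)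

theorem mul_mem_mulSpan_right (M : LieIdeal F L) (𝔞 : Ideal (UEA F L)) [𝔞.IsTwoSided]
    (u : UEA F L) {v : UEA F L} (hv : v ∈ mulSpan M 𝔞) : v * u ∈ mulSpan M 𝔞 := by
  refine Submodule.mul_induction_on hv ?_ ?_
  · intro x hx a ha
    rw [mul_assoc]
    exact Submodule.mul_mem_mul hx (Ideal.mul_mem_right u 𝔞 ha)
  · intro x y hx hy; rw [add_mul]; exact add_mem hx hy

theorem mul_mem_mulSpan_of_mem (M : LieIdeal F L) (𝔞 : Ideal (UEA F L)) {u v : UEA F L}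
    (hu : u ∈ mulSpan M ⊤) (hv : v ∈ 𝔞) : u * v ∈ mulSpan M 𝔞 := by
  refine Submodule.mul_induction_on hu ?_ ?_
  · intro x hx a _
    rw [mul_assoc]
    exact Submodule.mul_mem_mul hx (𝔞.mul_mem_left a hv)
  · intro x y hx hy; rw [add_mul]; exact add_mem hx hy

/-- `M𝔞`, for a two-sided ideal `𝔞` of `U(L)`, as a Lie ideal of `U(L)`. -/
def mulLie (M : LieIdeal F L) (𝔞 : Ideal (UEA F L)) [𝔞.IsTwoSided] : LieIdeal F (UEA F L) where
  __ := mulSpan M 𝔞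
  lie_mem := by
    intro u v hv
    rw [LieRing.of_associative_ring_bracket]
    exact sub_mem (mul_mem_mulSpan_left M 𝔞 u hv) (mul_mem_mulSpan_right M 𝔞 u hv)

/-- The ideal `MU(L)` of `U(L)`. -/
abbrev idealMU (M : LieIdeal F L) : LieIdeal F (UEA F L) := mulLie M ⊤

/-- `M𝔪` as a submodule of the `U(L)`-Lie-module `MU(L)`. -/
abbrev mulLieIn (M : LieIdeal F L) (𝔪 : Ideal (UEA F L)) [𝔪.IsTwoSided] :
    LieSubmodule F (UEA F L) (idealMU M) :=
  LieSubmodule.comap (LieSubmodule.incl (idealMU M)) (mulLie M 𝔪)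

/-- The vector space `Ĩ = MU(L) / M𝔪`. -/
def ITilde (M : LieIdeal F L) (𝔪 : Ideal (UEA F L)) [𝔪.IsTwoSided] :=
  idealMU M ⧸ mulLieIn M 𝔪

namespace ITilde

variable (M : LieIdeal F L) (𝔪 : Ideal (UEA F L)) [𝔪.IsTwoSided]

instance : AddCommGroup (ITilde M 𝔪) :=
  inferInstanceAs (AddCommGroup (idealMU M ⧸ mulLieIn M 𝔪))

instance : Module F (ITilde M 𝔪) :=
  inferInstanceAs (Module F (idealMU M ⧸ mulLieIn M 𝔪))

/-- The class `a + M𝔪` of `a ∈ MU(L)`. -/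
def mk : idealMU M →ₗ[F] ITilde M 𝔪 :=
  (mulLieIn M 𝔪).toSubmodule.mkQ

/-- The linear map `ϑ : M → Ĩ`, `x ↦ x + M𝔪`. -/
def theta : M →ₗ[F] ITilde M 𝔪 :=
  mk M 𝔪 ∘ₗ
    ((UniversalEnvelopingAlgebra.ι F : L →ₗ⁅F⁆ UEA F L).toLinearMap ∘ₗ
      M.toSubmodule.subtype).codRestrict (idealMU M).toSubmodule
      (fun x => by
        have h := Submodule.mul_mem_mul (N := (⊤ : Ideal (UEA F L)).restrictScalars F)
          (Submodule.mem_map_of_mem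
            (f := (UniversalEnvelopingAlgebra.ι F : L →ₗ⁅F⁆ UEA F L).toLinearMap) x.2)
          (show (1 : UEA F L) ∈ _ from trivial)
        rw [mul_one] at h
        exact h)

/-- The adjoint action of the Lie algebra `U(L)` on `Ĩ`: `w` maps `a + M𝔪` to
`⁅w, a⁆ + M𝔪`. -/
instance : LieRingModule (UEA F L) (ITilde M 𝔪) :=
  inferInstanceAs (LieRingModule (UEA F L) (idealMU M ⧸ mulLieIn M 𝔪))

instance : LieModule F (UEA F L) (ITilde M 𝔪) :=
  inferInstanceAs (LieModule F (UEA F L) (idealMU M ⧸ mulLieIn M 𝔪))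

/-- `Ĩ` is considered as an abelian Lie algebra. -/
instance : LieRing (ITilde M 𝔪) where
  bracket _ _ := 0
  add_lie _ _ _ := (add_zero 0).symm
  lie_add _ _ _ := (add_zero 0).symm
  lie_self _ := rfl
  leibniz_lie _ _ _ := (add_zero 0).symm

instance : LieAlgebra F (ITilde M 𝔪) where
  lie_smul c _ _ := (smul_zero c).symm

instance : IsLieAbelian (ITilde M 𝔪) := ⟨fun _ _ => rfl⟩

end ITilde

variable (M : LieIdeal F L) (𝔪 : Ideal (UEA F L)) [𝔪.IsTwoSided]

theorem idealMU_le_ker (h : (idealMU M).toSubmodule ≤ 𝔪.restrictScalars F) :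
    idealMU M ≤ (LieModule.toEnd F (UEA F L) (ITilde M 𝔪)).ker := by
  intro w hw
  rw [LieHom.mem_ker]
  refine LinearMap.ext fun q => ?_
  induction q using Submodule.Quotient.induction_on with
  | H a =>
    refine (Submodule.Quotient.mk_eq_zero (mulLieIn M 𝔪).toSubmodule).mpr ?_
    change w * (a : UEA F L) - (a : UEA F L) * w ∈ mulSpan M 𝔪
    exact sub_mem (mul_mem_mulSpan_of_mem M 𝔪 hw (h a.2)) (mul_mem_mulSpan_of_mem M 𝔪 a.2 (h hw))

/-- The homomorphism `β : U(L) / MU(L) → gl(Ĩ)` of Lie algebras,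
`β(w + MU(L))(a + M𝔪) = ⁅w, a⁆ + M𝔪`. -/
def beta (h : (idealMU M).toSubmodule ≤ 𝔪.restrictScalars F) :
    (UEA F L ⧸ idealMU M) →ₗ⁅F⁆ Module.End F (ITilde M 𝔪) :=
  quotLift (idealMU M) (LieModule.toEnd F (UEA F L) (ITilde M 𝔪)) (idealMU_le_ker M 𝔪 h)

/-- The Lie ideal `J` of `U(L)`: the preimage of `ker β` in `U(L)`. -/
def idealJ (h : (idealMU M).toSubmodule ≤ 𝔪.restrictScalars F) : LieIdeal F (UEA F L) :=
  ((beta M 𝔪 h).comp (quotMk (idealMU M))).ker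

/-- The Lie algebra `K̃ = U(L) / J`. -/
abbrev KTilde (h : (idealMU M).toSubmodule ≤ 𝔪.restrictScalars F) := UEA F L ⧸ idealJ M 𝔪 h

/-- The action of `K̃` on `Ĩ` induced by `β`. -/
def betaTilde (h : (idealMU M).toSubmodule ≤ 𝔪.restrictScalars F) :
    KTilde M 𝔪 h →ₗ⁅F⁆ Module.End F (ITilde M 𝔪) :=
  quotLift (idealJ M 𝔪 h) ((beta M 𝔪 h).comp (quotMk (idealMU M))) le_rfl

/-- The Lie algebra `L̃ = Ĩ ⋊ K̃`. -/
abbrev LTilde (h : (idealMU M).toSubmodule ≤ 𝔪.restrictScalars F) :=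
  LieAlgebra.SemiDirectSum (ITilde M 𝔪) (KTilde M 𝔪 h) (derOfEnd.comp (betaTilde M 𝔪 h))

/-- The subspace `𝔍 = J ∩ 𝔪` of `U(L)`. -/
def frakJ (h : (idealMU M).toSubmodule ≤ 𝔪.restrictScalars F) : Submodule F (UEA F L) :=
  (idealJ M 𝔪 h).toSubmodule ⊓ 𝔪.restrictScalars F

/-- The centralizer `C_L(M)` of the ideal `M` in `L`. -/
def centralizerIdeal : LieIdeal F L where
  carrier := {x | ∀ a ∈ M, ⁅x, a⁆ = 0}
  add_mem' hx hy a ha := by rw [add_lie, hx a ha, hy a ha, add_zero]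
  zero_mem' a _ := zero_lie a
  smul_mem' c x hx a ha := by rw [smul_lie, hx a ha, smul_zero]
  lie_mem {y x} hx a ha := by
    rw [lie_lie, hx a ha, lie_zero, hx _ (LieSubmodule.lie_mem M ha), sub_zero]

theorem centralizerIdeal_le_ker :
    centralizerIdeal M ≤ (LieModule.toEnd F L M).ker := by
  intro x hx
  rw [LieHom.mem_ker]
  ext a
  exact hx a a.2

/-- The action of `L / C_L(M)` on `M` induced by the adjoint action of `L`. -/
def adQuot : (L ⧸ centralizerIdeal M) →ₗ⁅F⁆ Module.End F M :=
  quotLift (centralizerIdeal M) (LieModule.toEnd F L M) (centralizerIdeal_le_ker M)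

/-- The semidirect sum `M ⋊ L / C_L(M)` for an abelian ideal `M`. -/
abbrev semiQuot [IsLieAbelian M] :=
  LieAlgebra.SemiDirectSum M (L ⧸ centralizerIdeal M) (derOfEnd.comp (adQuot M))

end LTilde

/-!
Let `ε : U(L) → F` be the algebra homomorphism with kernel `𝔪`. For `a ∈ MU(L)` the product
`a (w - ε w)` lies in `M𝔪`, so `w` acts on `Ĩ = MU(L) / M𝔪` as left multiplication by `w - ε w`.
Hence `J ∩ 𝔪` consists of the `w ∈ 𝔪` with `w MU(L) ⊆ M𝔪` (`mem_frakJ_iff`) and is two-sided. Since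
`1 ∈ J`, the space `J` is the direct sum of `F` and `J ∩ 𝔪`, and `U(L) / (J ∩ 𝔪) ≃ K̃ × F`
(`nonempty_quotient_frakJ_equiv`). The image of `M` is all of `Ĩ` (`theta_surjective`), and `K̃` acts
faithfully on `Ĩ`, which gives finite dimension. If `L / M` is abelian, then `U(L)` is commutative
modulo `MU(L) ⊆ J`, so `K̃` is abelian and `L̃` is metabelian.

The parts about `𝔪 = ω(L)` rest on `M ∩ M ω(L) = 0` (`eq_zero_of_ι_mem_mulSpan_augIdeal`): it makes
`M → Ĩ` injective, and if `x ∈ L ∩ J` and `a ∈ M`, then `⁅x, a⁆ ∈ M ∩ M ω(L)`. This needs the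
Poincaré–Birkhoff–Witt theorem in some form. Here it appears as the action of `L` on polynomials in
the elements of an ordered basis, in which a basis element `b i` multiplies each monomial whose
factors are all at least `i` (`monomialRep`). The action is defined by recursion on the degree of
the monomial; that it respects brackets is proved by induction on the degree, the only case that is
not part of the definition being an overlap settled by the Jacobi identity (`commOn_cons`). With an
ordered basis of `L` that starts with a basis of the abelian ideal `M`, the elements of `M` act by
multiplication, so the linear terms of the polynomial `u • 1` yield a linear map `Φ : U(L) → M` with
`Φ (x u) = ε u • x` for `x ∈ M`, which vanishes on `M ω(L)` and restricts to the identity of `M`.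
-/


/-! ### The action of a Lie algebra on ordered monomials -/

section OrderedMonomials

open Finsupp

theorem Multiset.forall_le_or_exists_cons {I : Type*} [LinearOrder I] (i : I) (m : Multiset I) :
    (∀ k ∈ m, i ≤ k) ∨ ∃ j m', m = j ::ₘ m' ∧ j < i ∧ ∀ k ∈ m', j ≤ k := by
  induction m using Multiset.induction_on with
  | empty => exact Or.inl (by simp)
  | cons a m ih =>
    rcases ih with h | ⟨j, m', rfl, hj, hm'⟩
    · rcases le_or_gt i a with ha | ha
      · exact Or.inl (by simpa [ha] using h)
      · exact Or.inr ⟨a, m, rfl, ha, fun k hk => ha.le.trans (h k hk)⟩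
    · refine Or.inr ?_
      rcases le_or_gt j a with ha | ha
      · exact ⟨j, a ::ₘ m', Multiset.cons_swap _ _ _, hj, by simpa [ha] using hm'⟩
      · exact ⟨a, j ::ₘ m', rfl, ha.trans hj, by
          simpa [ha.le] using fun k hk => ha.le.trans (hm' k hk)⟩

variable {F L I : Type*} [Field F] [LieRing L] [LieAlgebra F L] {b : Module.Basis I F L}

/-- The polynomials of degree at most `d`, polynomials in variables indexed by `I` being encoded as
linear combinations of multisets; the monomial `m` is `single m 1`, and `i ::ₘ m` is its product
with the variable `i`. -/
noncomputable def degreeLE (F I : Type*) [Field F] (d : ℕ) : Submodule F (Multiset I →₀ F) :=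
  Submodule.span F ((fun m => single m 1) '' {m | m.card ≤ d})

theorem single_mem_degreeLE {d : ℕ} {m : Multiset I} (h : m.card ≤ d) :
    single m (1 : F) ∈ degreeLE F I d :=
  Submodule.subset_span ⟨m, h, rfl⟩

theorem degreeLE_mono {d e : ℕ} (h : d ≤ e) : degreeLE F I d ≤ degreeLE F I e :=
  Submodule.span_mono (Set.image_mono fun _ hm => le_trans hm h)

theorem exists_mem_degreeLE (p : Multiset I →₀ F) : ∃ d, p ∈ degreeLE F I d := by
  refine ⟨p.support.sup Multiset.card, ?_⟩
  rw [degreeLE, ← supported_eq_span_single]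
  exact fun m hm => Finset.le_sup (f := Multiset.card) hm

/-- `A` and `A'` agree on the monomials of degree less than `n`. -/
def AgreeBelow (n : ℕ) (A A' : L →ₗ[F] Module.End F (Multiset I →₀ F)) : Prop :=
  ∀ (x : L) (m : Multiset I), m.card < n → A x (single m 1) = A' x (single m 1)

theorem AgreeBelow.apply_eq {n : ℕ} {A A' : L →ₗ[F] Module.End F (Multiset I →₀ F)}
    (h : AgreeBelow n A A') {d : ℕ} (hd : d < n) (x : L) {p : Multiset I →₀ F}
    (hp : p ∈ degreeLE F I d) : A x p = A' x p := by
  induction hp using Submodule.span_induction with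
  | zero => simp
  | add p q _ _ hp hq => rw [map_add, map_add, hp, hq]
  | smul c p _ hp => rw [map_smul, map_smul, hp]
  | mem p hp => obtain ⟨m, hm, rfl⟩ := hp; exact h x m (lt_of_le_of_lt hm hd)

theorem agreeBelow_of_basis {n : ℕ} {A A' : L →ₗ[F] Module.End F (Multiset I →₀ F)}
    (h : ∀ (i : I) (m : Multiset I), m.card < n → A (b i) (single m 1) = A' (b i) (single m 1)) :
    AgreeBelow n A A' := fun x m hm =>
  DFunLike.congr_fun (b.ext (f₁ := A.flip (single m 1)) (f₂ := A'.flip (single m 1))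
    fun i => h i m hm) x

/-- `⁅x, y⁆` acts on `p` as the commutator of `x` and `y`. -/
def CommOn (A : L →ₗ[F] Module.End F (Multiset I →₀ F)) (x y : L) (p : Multiset I →₀ F) : Prop :=
  A x (A y p) = A y (A x p) + A ⁅x, y⁆ p

theorem CommOn.symm {A : L →ₗ[F] Module.End F (Multiset I →₀ F)} {x y : L} {p : Multiset I →₀ F}
    (h : CommOn A x y p) : CommOn A y x p := by
  unfold CommOn at h ⊢
  rw [h, ← lie_skew, map_neg, LinearMap.neg_apply]; abel

theorem CommOn.add {A : L →ₗ[F] Module.End F (Multiset I →₀ F)} {x y : L} {p q : Multiset I →₀ F}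
    (hp : CommOn A x y p) (hq : CommOn A x y q) : CommOn A x y (p + q) := by
  unfold CommOn at hp hq ⊢
  simp only [map_add, hp, hq]; abel

theorem CommOn.of_basis {A : L →ₗ[F] Module.End F (Multiset I →₀ F)} {p : Multiset I →₀ F}
    (h : ∀ i j, CommOn A (b i) (b j) p) (x y : L) : CommOn A x y p := by
  unfold CommOn at h ⊢
  induction b.mem_span x using Submodule.span_induction with
  | mem x hx =>
    obtain ⟨i, rfl⟩ := hx
    induction b.mem_span y using Submodule.span_induction with
    | mem y hy => obtain ⟨j, rfl⟩ := hy; exact h i j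
    | zero => simp
    | add y z _ _ hy hz =>
      simp only [map_add, LinearMap.add_apply, lie_add, hy, hz]; abel
    | smul c y _ hy => simp only [map_smul, LinearMap.smul_apply, lie_smul, hy, smul_add]
  | zero => simp
  | add x z _ _ hx hz => simp only [map_add, LinearMap.add_apply, add_lie, hx, hz]; abel
  | smul c x _ hx => simp only [map_smul, LinearMap.smul_apply, smul_lie, hx, smul_add]

variable (b) in
/-- `A` is, up to terms of the same degree, multiplication by variables on the monomials of degree
less than `n`. -/
def RaisesDegree (n : ℕ) (A : L →ₗ[F] Module.End F (Multiset I →₀ F)) : Prop :=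
  ∀ (i : I) (m : Multiset I), m.card < n →
    A (b i) (single m 1) - single (i ::ₘ m) 1 ∈ degreeLE F I m.card

theorem RaisesDegree.apply_mem {n : ℕ} {A : L →ₗ[F] Module.End F (Multiset I →₀ F)}
    (hA : RaisesDegree b n A) {d : ℕ} (hd : d < n) (x : L) {p : Multiset I →₀ F}
    (hp : p ∈ degreeLE F I d) : A x p ∈ degreeLE F I (d + 1) := by
  induction hp using Submodule.span_induction with
  | zero => rw [map_zero]; exact zero_mem _
  | add p q _ _ hp hq => rw [map_add]; exact add_mem hp hq
  | smul c p _ hp => rw [map_smul]; exact Submodule.smul_mem _ c hp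
  | mem p hp =>
    obtain ⟨m, hm, rfl⟩ := hp
    rw [Set.mem_ofPred_eq] at hm
    induction b.mem_span x using Submodule.span_induction with
    | mem x hx =>
      obtain ⟨i, rfl⟩ := hx
      rw [← sub_add_cancel (A (b i) (single m 1)) (single (i ::ₘ m) 1)]
      exact add_mem (degreeLE_mono (by omega) (hA i m (by omega)))
        (single_mem_degreeLE (by simpa using hm))
    | zero => rw [map_zero]; exact zero_mem _
    | add x y _ _ hx hy => rw [map_add]; exact add_mem hx hy
    | smul c x _ hx => rw [map_smul]; exact Submodule.smul_mem _ c hx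

variable [LinearOrder I]

variable (b) in
/-- One step of the recursion for the action: `b i` multiplies a monomial `m` by the variable `i`
unless `m = j m'` with `j < i` minimal, in which case `A` supplies the terms
`b j • (b i • m' - i m') + ⁅b i, b j⁆ • m'` of lower degree. -/
noncomputable def actStep (A : L →ₗ[F] Module.End F (Multiset I →₀ F)) :
    L →ₗ[F] Module.End F (Multiset I →₀ F) :=
  b.constr F fun i => linearCombination F fun m =>
    single (i ::ₘ m) 1 +
      match m.sort (· ≤ ·) with
      | [] => 0
      | j :: l => if i ≤ j then 0 else
          A (b j) (A (b i) (single (l : Multiset I) 1) - single (i ::ₘ (l : Multiset I)) 1) +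
            A ⁅b i, b j⁆ (single (l : Multiset I) 1)

variable (b) in
theorem actStep_of_le (A : L →ₗ[F] Module.End F (Multiset I →₀ F)) {i : I} {m : Multiset I}
    (h : ∀ k ∈ m, i ≤ k) : actStep b A (b i) (single m 1) = single (i ::ₘ m) 1 := by
  rw [actStep, Module.Basis.constr_basis, linearCombination_single, one_smul]
  split
  · rw [add_zero]
  · next j l hl =>
    have : j ∈ m := by rw [← Multiset.mem_sort (r := (· ≤ ·)), hl]; simp
    rw [if_pos (h j this), add_zero]

variable (b) in
theorem actStep_of_lt (A : L →ₗ[F] Module.End F (Multiset I →₀ F)) {i j : I} {m : Multiset I}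
    (hj : j < i) (h : ∀ k ∈ m, j ≤ k) :
    actStep b A (b i) (single (j ::ₘ m) 1) = single (i ::ₘ j ::ₘ m) 1 +
      (A (b j) (A (b i) (single m 1) - single (i ::ₘ m) 1) + A ⁅b i, b j⁆ (single m 1)) := by
  rw [actStep, Module.Basis.constr_basis, linearCombination_single, one_smul,
    Multiset.sort_cons (r := (· ≤ ·)) j m h]
  simp only [not_le.mpr hj, if_false, Multiset.sort_eq]

theorem RaisesDegree.actStep {n : ℕ} {A : L →ₗ[F] Module.End F (Multiset I →₀ F)}
    (hA : RaisesDegree b n A) : RaisesDegree b (n + 1) (actStep b A) := by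
  intro i m hm
  rcases m.forall_le_or_exists_cons i with h | ⟨j, m, rfl, hj, h⟩
  · rw [actStep_of_le b A h, sub_self]; exact zero_mem _
  · rw [Multiset.card_cons] at hm ⊢
    rw [actStep_of_lt b A hj h, add_sub_cancel_left]
    exact add_mem (hA.apply_mem (by omega) _ (hA i m (by omega)))
      (hA.apply_mem (by omega) _ (single_mem_degreeLE le_rfl))

theorem AgreeBelow.actStep {n : ℕ} {A A' : L →ₗ[F] Module.End F (Multiset I →₀ F)}
    (h : AgreeBelow n A A') (hA : RaisesDegree b n A) :
    AgreeBelow (n + 1) (actStep b A) (actStep b A') := by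
  refine agreeBelow_of_basis (b := b) fun i m hm => ?_
  rcases m.forall_le_or_exists_cons i with hi | ⟨j, m, rfl, hj, hi⟩
  · rw [actStep_of_le b A hi, actStep_of_le b A' hi]
  · rw [Multiset.card_cons] at hm
    have hm' : m.card < n := by omega
    rw [actStep_of_lt b A hj hi, actStep_of_lt b A' hj hi, ← h _ m hm', ← h _ m hm',
      h.apply_eq hm' _ (hA i m hm')]

/-- The starting point `0` of the iteration does not matter: the `n`-th iterate is determined on the
monomials of degree less than `n`. -/
theorem raisesDegree_iterate (n : ℕ) : RaisesDegree b n ((actStep b)^[n] 0) := by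
  induction n with
  | zero => intro i m hm; omega
  | succ n ih => rw [Function.iterate_succ_apply']; exact ih.actStep

theorem agreeBelow_iterate_succ (n : ℕ) :
    AgreeBelow n ((actStep b)^[n] 0) ((actStep b)^[n + 1] 0) := by
  induction n with
  | zero => intro x m hm; omega
  | succ n ih =>
    rw [Function.iterate_succ_apply' _ n, Function.iterate_succ_apply' _ (n + 1)]
    exact ih.actStep (raisesDegree_iterate n)

theorem agreeBelow_iterate {n k : ℕ} (h : n ≤ k) :
    AgreeBelow n ((actStep b)^[n] 0) ((actStep b)^[k] 0) := by
  induction k, h using Nat.le_induction with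
  | base => exact fun _ _ _ => rfl
  | succ k hk ih =>
    exact fun x m hm => (ih x m hm).trans (agreeBelow_iterate_succ k x m (by omega))

variable (b) in
/-- The action of `L` on polynomials in the elements of an ordered basis, for which a basis element
multiplies the monomials all of whose factors are not smaller; the limit of the iterates of
`actStep`. -/
noncomputable def monomialAct : L →ₗ[F] Module.End F (Multiset I →₀ F) :=
  b.constr F fun i => linearCombination F fun m =>
    (actStep b)^[m.card + 1] 0 (b i) (single m 1)

theorem monomialAct_agreeBelow (n : ℕ) :
    AgreeBelow n (monomialAct b) ((actStep b)^[n] 0) := by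
  refine agreeBelow_of_basis (b := b) fun i m hm => ?_
  rw [monomialAct, Module.Basis.constr_basis, linearCombination_single, one_smul]
  exact agreeBelow_iterate (by omega) _ m (by omega)

theorem monomialAct_raisesDegree (n : ℕ) : RaisesDegree b n (monomialAct b) := fun i m hm => by
  rw [monomialAct_agreeBelow n _ m hm]
  exact raisesDegree_iterate n i m hm

theorem actStep_monomialAct : actStep b (monomialAct b) = monomialAct b := by
  refine LinearMap.ext fun x => Finsupp.lhom_ext' fun m => LinearMap.ext_ring ?_
  have h := (monomialAct_agreeBelow (b := b) m.card).actStep (monomialAct_raisesDegree _)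
  rw [← Function.iterate_succ_apply' (actStep b)] at h
  exact (h x m (by omega)).trans (monomialAct_agreeBelow _ x m (by omega)).symm

theorem monomialAct_of_le {i : I} {m : Multiset I} (h : ∀ k ∈ m, i ≤ k) :
    monomialAct b (b i) (single m 1) = single (i ::ₘ m) 1 := by
  rw [← actStep_monomialAct, actStep_of_le b _ h]

theorem monomialAct_of_lt {i j : I} {m : Multiset I} (hj : j < i) (h : ∀ k ∈ m, j ≤ k) :
    monomialAct b (b i) (single (j ::ₘ m) 1) = single (i ::ₘ j ::ₘ m) 1 +
      (monomialAct b (b j) (monomialAct b (b i) (single m 1) - single (i ::ₘ m) 1) +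
        monomialAct b ⁅b i, b j⁆ (single m 1)) := by
  conv_lhs => rw [← actStep_monomialAct, actStep_of_lt b _ hj h]

/-- The defining recursion of `monomialAct`, read as an instance of the commutator rule. -/
theorem commOn_of_le {i j : I} {m : Multiset I} (h : ∀ k ∈ m, j ≤ k) (hj : j ≤ i) :
    CommOn (monomialAct b) (b i) (b j) (single m 1) := by
  unfold CommOn
  rcases hj.eq_or_lt with rfl | hj
  · simp
  · have e : monomialAct b (b j) (single (i ::ₘ m) 1) = single (i ::ₘ j ::ₘ m) (1 : F) := by
      rw [monomialAct_of_le (by simpa [hj.le] using h), Multiset.cons_swap]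
    rw [monomialAct_of_le h, monomialAct_of_lt hj h, map_sub, e]
    abel

/-- The overlap step: if `k` is not larger than the factors of `m` and smaller than `i` and `j`,
the Jacobi identity reduces the commutator rule on `k m` to lower degree. -/
theorem commOn_cons {i j k : I} {m : Multiset I} (hi : k < i) (hj : k < j) (hm : ∀ l ∈ m, k ≤ l)
    (ih : ∀ p ∈ degreeLE F I m.card, ∀ x y, CommOn (monomialAct b) x y p) :
    CommOn (monomialAct b) (b i) (b j) (single (k ::ₘ m) 1) := by
  -- `b j • m` is `j m`, to which `commOn_of_le` applies, up to terms of the degree of `m`.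
  have key : ∀ {i j : I}, k < i → k < j →
      CommOn (monomialAct b) (b i) (b k) (monomialAct b (b j) (single m 1)) := by
    intro i j hi hj
    rw [← sub_add_cancel (monomialAct b (b j) (single m 1)) (single (j ::ₘ m) 1)]
    refine CommOn.add (ih _ (monomialAct_raisesDegree (m.card + 1) j m (by omega)) _ _)
      (commOn_of_le (by simpa [hj.le] using hm) hi.le)
  have hkm : single (k ::ₘ m) (1 : F) = monomialAct b (b k) (single m 1) :=
    (monomialAct_of_le hm).symm
  have ih := ih _ (single_mem_degreeLE le_rfl)
  unfold CommOn at *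
  -- `b k` can be moved past `b i` and `b j`; what remains are brackets acting on `m`.
  have jac : ⁅b i, ⁅b j, b k⁆⁆ = ⁅b j, ⁅b i, b k⁆⁆ + ⁅⁅b i, b j⁆, b k⁆ := by
    rw [leibniz_lie, add_comm]
  have e := congrArg (fun x => monomialAct b x (single m 1)) jac
  simp only [map_add, LinearMap.add_apply] at e
  rw [hkm, ih (b j) (b k), ih (b i) (b k), map_add, map_add, key hi hj, key hj hi,
    ih (b i) (b j), ih (b i) ⁅b j, b k⁆, ih (b j) ⁅b i, b k⁆, ih ⁅b i, b j⁆ (b k), map_add, e]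
  abel

theorem commOn_monomialAct (x y : L) (p : Multiset I →₀ F) :
    CommOn (monomialAct b) x y p := by
  have H : ∀ d : ℕ, ∀ p ∈ degreeLE F I d, ∀ x y, CommOn (monomialAct b) x y p := by
    intro d
    induction d using Nat.strong_induction_on with
    | _ d ih =>
    intro p hp
    induction hp using Submodule.span_induction with
    | zero => intro x y; simp [CommOn]
    | add p q _ _ hp hq => exact fun x y => (hp x y).add (hq x y)
    | smul c p _ hp =>
      intro x y
      have := hp x y
      unfold CommOn at this ⊢
      simp only [map_smul, this, smul_add]
    | mem p hp =>
      obtain ⟨m, hm, rfl⟩ := hp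
      rw [Set.mem_ofPred_eq] at hm
      refine CommOn.of_basis (b := b) fun i j => ?_
      rcases m.forall_le_or_exists_cons i with h | ⟨k, m', rfl, hk, h⟩
      · rcases le_total i j with hij | hij
        · exact (commOn_of_le h hij).symm
        · exact commOn_of_le (fun k hk => hij.trans (h k hk)) hij
      · rcases le_or_gt j k with hjk | hjk
        · refine commOn_of_le ?_ (hjk.trans hk.le)
          simpa [hjk] using fun l hl => hjk.trans (h l hl)
        · rw [Multiset.card_cons] at hm
          exact commOn_cons hk hjk h (ih _ (by omega))
  obtain ⟨d, hd⟩ := exists_mem_degreeLE p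
  exact H d p hd x y

variable (b) in
/-- The representation of `U(L)` on polynomials in the elements of an ordered basis of `L`. -/
noncomputable def monomialRep :
    UEA F L →ₐ[F] Module.End F (Multiset I →₀ F) :=
  UniversalEnvelopingAlgebra.lift F
    { monomialAct b with
      map_lie' := by
        intro x y
        refine LinearMap.ext fun p => ?_
        rw [LieRing.of_associative_ring_bracket]
        exact eq_sub_of_add_eq' (Eq.symm (commOn_monomialAct x y p)) }

theorem monomialRep_ι (x : L) :
    monomialRep b (UniversalEnvelopingAlgebra.ι F x) = monomialAct b x :=
  UniversalEnvelopingAlgebra.lift_ι_apply F _ x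

/-- The constant term of a polynomial is killed by the action of `L`. -/
theorem monomialAct_apply_zero (x : L) (p : Multiset I →₀ F) : monomialAct b x p 0 = 0 := by
  have H : ∀ d : ℕ, ∀ p ∈ degreeLE F I d, ∀ x, monomialAct b x p 0 = 0 := by
    intro d
    induction d using Nat.strong_induction_on with
    | _ d ih =>
    intro p hp
    induction hp using Submodule.span_induction with
    | zero => simp
    | add p q _ _ hp hq => intro x; rw [map_add, Finsupp.add_apply, hp, hq, add_zero]
    | smul c p _ hp => intro x; rw [map_smul, Finsupp.smul_apply, hp, smul_zero]
    | mem p hp =>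
      obtain ⟨m, hm, rfl⟩ := hp
      rw [Set.mem_ofPred_eq] at hm
      intro x
      induction b.mem_span x using Submodule.span_induction with
      | mem x hx =>
        obtain ⟨i, rfl⟩ := hx
        rcases m.forall_le_or_exists_cons i with h | ⟨j, m, rfl, hj, h⟩
        · rw [monomialAct_of_le h]
          exact Finsupp.single_eq_of_ne (Multiset.cons_ne_zero).symm
        · rw [Multiset.card_cons] at hm
          rw [monomialAct_of_lt hj h, Finsupp.add_apply, Finsupp.add_apply,
            ih m.card (by omega) _ (monomialAct_raisesDegree (m.card + 1) i m (by omega)),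
            ih m.card (by omega) _ (single_mem_degreeLE le_rfl), add_zero, add_zero]
          exact Finsupp.single_eq_of_ne (Multiset.cons_ne_zero).symm
      | zero => simp
      | add x y _ _ hx hy => rw [map_add, LinearMap.add_apply, Finsupp.add_apply, hx, hy, add_zero]
      | smul c x _ hx => rw [map_smul, LinearMap.smul_apply, Finsupp.smul_apply, hx, smul_zero]
  obtain ⟨d, hd⟩ := exists_mem_degreeLE p
  exact H d p hd x

/-- The constant term is a homomorphism to the trivial `U(L)`-module. -/
theorem monomialRep_apply_zero (u : UEA F L) (p : Multiset I →₀ F) :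
    monomialRep b u p 0 = UniversalEnvelopingAlgebra.lift F (0 : L →ₗ⁅F⁆ F) u * p 0 := by
  have hu : u ∈ Algebra.adjoin F (Set.range (UniversalEnvelopingAlgebra.ι F : L → UEA F L)) := by
    rw [adjoin_range_ι]; trivial
  induction hu using Algebra.adjoin_induction generalizing p with
  | mem u hu =>
    obtain ⟨x, rfl⟩ := hu
    rw [monomialRep_ι, monomialAct_apply_zero, UniversalEnvelopingAlgebra.lift_ι_apply,
      LieHom.zero_apply, zero_mul]
  | algebraMap r => simp [AlgHom.commutes, Module.algebraMap_end_apply]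
  | add u v _ _ hu hv => rw [map_add, map_add, LinearMap.add_apply, Finsupp.add_apply, hu, hv,
      add_mul]
  | mul u v _ _ hu hv => rw [map_mul, map_mul, Module.End.mul_apply, hu, hv, mul_assoc]

/-- A basis element that commutes with all smaller ones multiplies every monomial. -/
theorem monomialAct_of_lie_eq_zero {i : I} (hi : ∀ j < i, ⁅b i, b j⁆ = 0) (m : Multiset I) :
    monomialAct b (b i) (single m 1) = single (i ::ₘ m) 1 := by
  induction hn : m.card generalizing m with
  | zero => exact monomialAct_of_le (by simp [Multiset.card_eq_zero.mp hn])
  | succ n ih =>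
    rcases m.forall_le_or_exists_cons i with h | ⟨j, m, rfl, hj, h⟩
    · exact monomialAct_of_le h
    · rw [monomialAct_of_lt hj h, ih m (by simpa using hn), sub_self, map_zero, hi j hj, map_zero,
        LinearMap.zero_apply, add_zero, add_zero]

end OrderedMonomials

/-! ### An abelian ideal in the enveloping algebra -/

section AbelianIdeal

variable {F L : Type*} [Field F] [LieRing L] [LieAlgebra F L]

/-- An abelian ideal `M` is a quotient of the right `U(L)`-module `MU(L)`, on which `U(L)` acts
through the augmentation. This is where a basis of `U(L)` is needed: for a basis of `L` that starts
with a basis of `M`, the value is read off from the linear terms of the polynomial `u • 1`. -/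
theorem exists_linearMap_mul_eq_augmentation_smul [FiniteDimensional F L] (M : LieIdeal F L)
    [IsLieAbelian M] :
    ∃ Φ : UEA F L →ₗ[F] M, ∀ (x : M) (u : UEA F L),
      Φ (UniversalEnvelopingAlgebra.ι F (x : L) * u) =
        UniversalEnvelopingAlgebra.lift F (0 : L →ₗ⁅F⁆ F) u • x := by
  obtain ⟨N, hN⟩ := Submodule.exists_isCompl M.toSubmodule
  let bM : Module.Basis _ F M := Module.finBasis F M
  let b₀ := (bM.prod (Module.finBasis F N)).map (Submodule.prodEquivOfIsCompl _ N hN)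
  -- The lexicographic order of the sum puts the basis of `M` first.
  let b := b₀.reindex toLex
  have hb : ∀ i, b (Sum.inlₗ i) = bM i := fun i => by
    change Submodule.prodEquivOfIsCompl _ N hN _ = _
    simp [Sum.inlₗ]
  have hlie : ∀ i, ∀ j < Sum.inlₗ i, ⁅b (Sum.inlₗ i), b j⁆ = 0 := by
    intro i j hj
    rcases j with j | j
    · change ⁅b (Sum.inlₗ i), b (Sum.inlₗ j)⁆ = 0
      rw [hb, hb]
      exact congrArg Subtype.val (trivial_lie_zero M M (bM i) (bM j))
    · exact absurd hj Sum.Lex.not_inr_lt_inl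
  -- The linear terms of a polynomial in the variables that belong to `M`.
  let lin : (Multiset (Fin (Module.finrank F M) ⊕ₗ Fin (Module.finrank F N)) →₀ F) →ₗ[F] M :=
    ∑ i, (Finsupp.lapply {Sum.inlₗ i}).smulRight (bM i)
  have hlin : ∀ i p, lin (monomialAct b (b (Sum.inlₗ i)) p) = p 0 • bM i := by
    intro i p
    induction p using Finsupp.induction_linear with
    | zero => simp
    | add p q hp hq => rw [map_add, map_add, hp, hq, Finsupp.add_apply, add_smul]
    | single m c =>
      rw [← mul_one c, ← smul_eq_mul, ← Finsupp.smul_single, map_smul, map_smul,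
        monomialAct_of_lie_eq_zero (hlie i), Finsupp.smul_apply, smul_assoc]
      congr 1
      simp only [lin, LinearMap.sum_apply, LinearMap.smulRight_apply, Finsupp.lapply_apply]
      by_cases hm : m = 0
      · subst hm
        rw [Finset.sum_eq_single i]
        · rw [Multiset.cons_zero, Finsupp.single_eq_same, Finsupp.single_eq_same]
        · intro k _ hk
          rw [Finsupp.single_eq_of_ne, zero_smul]
          simpa [Sum.inlₗ] using hk
        · simp
      · rw [Finsupp.single_eq_of_ne (Ne.symm hm), zero_smul]
        refine Finset.sum_eq_zero fun k _ => ?_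
        rw [Finsupp.single_eq_of_ne, zero_smul]
        intro h
        exact hm (by simpa using congrArg Multiset.card h.symm)
  let ev : UEA F L →ₗ[F] (Multiset (Fin (Module.finrank F M) ⊕ₗ Fin (Module.finrank F N)) →₀ F) :=
    (LinearMap.applyₗ (Finsupp.single 0 1)) ∘ₗ (monomialRep b).toLinearMap
  refine ⟨lin ∘ₗ ev, fun x u => ?_⟩
  induction bM.mem_span x using Submodule.span_induction with
  | mem x hx =>
    obtain ⟨i, rfl⟩ := hx
    change lin (monomialRep b (_ * u) (Finsupp.single 0 1)) = _
    rw [map_mul, Module.End.mul_apply, monomialRep_ι, ← hb, hlin, monomialRep_apply_zero]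
    simp
  | zero => simp
  | add x y _ _ hx hy =>
    rw [Submodule.coe_add, map_add, add_mul, map_add, hx, hy, smul_add]
  | smul c x _ hx =>
    rw [Submodule.coe_smul, map_smul, smul_mul_assoc, map_smul, hx, smul_comm]

end AbelianIdeal


/-! ### The ideals `J` and `J ∩ 𝔪` -/

section CodimensionOne

variable {F L : Type*} [Field F] [LieRing L] [LieAlgebra F L]
  {M : LieIdeal F L} {𝔪 : Ideal (UEA F L)} [𝔪.IsTwoSided]

theorem exists_algHom_ker_eq (hcodim : Nonempty ((UEA F L ⧸ 𝔪) ≃ₐ[F] F)) :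
    ∃ ε : UEA F L →ₐ[F] F, ∀ u, u ∈ 𝔪 ↔ ε u = 0 := by
  obtain ⟨e⟩ := hcodim
  refine ⟨e.toAlgHom.comp (Ideal.Quotient.mkₐ F 𝔪), fun u => ?_⟩
  change _ ↔ e (Ideal.Quotient.mk 𝔪 u) = 0
  rw [EmbeddingLike.map_eq_zero_iff, Ideal.Quotient.eq_zero_iff_mem]

theorem ι_mul_mem_mulSpan {𝔞 : Ideal (UEA F L)} {x : L} (hx : x ∈ M) {u : UEA F L} (hu : u ∈ 𝔞) :
    UniversalEnvelopingAlgebra.ι F x * u ∈ mulSpan M 𝔞 :=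
  Submodule.mul_mem_mul (N := 𝔞.restrictScalars F) (Submodule.mem_map_of_mem hx) hu

theorem ι_mem_mulSpan_top {x : L} (hx : x ∈ M) :
    UniversalEnvelopingAlgebra.ι F x ∈ mulSpan M ⊤ := by
  rw [← mul_one (UniversalEnvelopingAlgebra.ι F x)]
  exact ι_mul_mem_mulSpan hx trivial

/-- A property of the elements of `M𝔞` may be checked on products. -/
@[elab_as_elim]
theorem mulSpan_induction {𝔞 : Ideal (UEA F L)} {C : UEA F L → Prop}
    (mul : ∀ x ∈ M, ∀ u ∈ 𝔞, C (UniversalEnvelopingAlgebra.ι F x * u))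
    (add : ∀ v w, C v → C w → C (v + w)) {v : UEA F L} (hv : v ∈ mulSpan M 𝔞) : C v := by
  refine Submodule.mul_induction_on hv ?_ add
  rintro _ ⟨x, hx, rfl⟩ u hu
  exact mul x hx u hu

theorem beta_mk (hM : (idealMU M).toSubmodule ≤ 𝔪.restrictScalars F) (w : UEA F L)
    (a : idealMU M) :
    beta M 𝔪 hM (quotMk (idealMU M) w) (ITilde.mk M 𝔪 a) = ITilde.mk M 𝔪 ⁅w, a⁆ :=
  rfl

theorem mem_idealJ_iff (hM : (idealMU M).toSubmodule ≤ 𝔪.restrictScalars F) {w : UEA F L} :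
    w ∈ idealJ M 𝔪 hM ↔ ∀ a ∈ mulSpan M ⊤, w * a - a * w ∈ mulSpan M 𝔪 := by
  rw [idealJ, LieHom.mem_ker]
  have key : ∀ a : idealMU M, ITilde.mk M 𝔪 ⁅w, a⁆ = 0 ↔
      w * (a : UEA F L) - (a : UEA F L) * w ∈ mulSpan M 𝔪 := fun a =>
    Submodule.Quotient.mk_eq_zero (mulLieIn M 𝔪).toSubmodule
  constructor
  · intro h a ha
    exact (key ⟨a, ha⟩).mp (LinearMap.congr_fun h (ITilde.mk M 𝔪 ⟨a, ha⟩))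
  · intro h
    refine LinearMap.ext fun q => ?_
    obtain ⟨a, rfl⟩ := Submodule.mkQ_surjective (mulLieIn M 𝔪).toSubmodule q
    exact (key a).mpr (h a a.2)

theorem mem_frakJ_iff (hM : (idealMU M).toSubmodule ≤ 𝔪.restrictScalars F) {w : UEA F L} :
    w ∈ frakJ M 𝔪 hM ↔ w ∈ 𝔪 ∧ ∀ a ∈ mulSpan M ⊤, w * a ∈ mulSpan M 𝔪 := by
  change w ∈ idealJ M 𝔪 hM ∧ w ∈ 𝔪 ↔ _
  rw [mem_idealJ_iff, and_comm]
  refine and_congr_right fun hw => forall₂_congr fun a ha => ?_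
  exact (mulSpan M 𝔪).sub_mem_iff_left (mul_mem_mulSpan_of_mem M 𝔪 ha hw)

theorem one_mem_idealJ (hM : (idealMU M).toSubmodule ≤ 𝔪.restrictScalars F) :
    (1 : UEA F L) ∈ idealJ M 𝔪 hM :=
  (mem_idealJ_iff hM).mpr fun a _ => by rw [one_mul, mul_one, sub_self]; exact zero_mem _

theorem mul_mem_frakJ (hM : (idealMU M).toSubmodule ≤ 𝔪.restrictScalars F) (u : UEA F L)
    {w : UEA F L} (hw : w ∈ frakJ M 𝔪 hM) :
    u * w ∈ frakJ M 𝔪 hM ∧ w * u ∈ frakJ M 𝔪 hM := by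
  rw [mem_frakJ_iff] at hw ⊢
  rw [mem_frakJ_iff]
  refine ⟨⟨𝔪.mul_mem_left u hw.1, fun a ha => ?_⟩, ⟨𝔪.mul_mem_right u hw.1, fun a ha => ?_⟩⟩
  · rw [mul_assoc]; exact mul_mem_mulSpan_left M 𝔪 u (hw.2 a ha)
  · rw [mul_assoc]; exact hw.2 _ (mul_mem_mulSpan_left M ⊤ u ha)

theorem idealMU_le_idealJ (hM : (idealMU M).toSubmodule ≤ 𝔪.restrictScalars F) :
    idealMU M ≤ idealJ M 𝔪 hM := fun _ hw => by
  rw [mem_idealJ_iff]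
  exact fun a ha => sub_mem (mul_mem_mulSpan_of_mem M 𝔪 hw (hM ha))
    (mul_mem_mulSpan_of_mem M 𝔪 ha (hM hw))

theorem quotMk_surjective {A : Type*} [LieRing A] [LieAlgebra F A] (I : LieIdeal F A) :
    Function.Surjective (quotMk I) :=
  Submodule.mkQ_surjective I.toSubmodule

theorem quotMk_eq_zero {A : Type*} [LieRing A] [LieAlgebra F A] {I : LieIdeal F A} {x : A} :
    quotMk I x = 0 ↔ x ∈ I :=
  Submodule.Quotient.mk_eq_zero I.toSubmodule

theorem mem_idealJ_iff_beta (hM : (idealMU M).toSubmodule ≤ 𝔪.restrictScalars F) {w : UEA F L} :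
    w ∈ idealJ M 𝔪 hM ↔ beta M 𝔪 hM (quotMk (idealMU M) w) = 0 :=
  LieHom.mem_ker

/-- `J` is determined by `MU(L) ⊆ J` and `J / MU(L) = ker β`. -/
theorem eq_idealJ_iff (hM : (idealMU M).toSubmodule ≤ 𝔪.restrictScalars F)
    (J : LieIdeal F (UEA F L)) :
    (idealMU M ≤ J ∧
      J.toSubmodule.map (quotMk (idealMU M)).toLinearMap = (beta M 𝔪 hM).ker.toSubmodule) ↔
    J = idealJ M 𝔪 hM := by
  constructor
  · rintro ⟨hle, hmap⟩
    ext w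
    rw [mem_idealJ_iff_beta]
    have : quotMk (idealMU M) w ∈ J.toSubmodule.map (quotMk (idealMU M)).toLinearMap ↔
        beta M 𝔪 hM (quotMk (idealMU M) w) = 0 := by
      rw [hmap]; exact LieHom.mem_ker
    rw [← this]
    constructor
    · exact fun hw => Submodule.mem_map_of_mem hw
    · rintro ⟨v, hv, hvw⟩
      have h : quotMk (idealMU M) (w - v) = 0 := by
        rw [map_sub, sub_eq_zero]; exact hvw.symm
      rw [← sub_add_cancel w v]
      exact add_mem (hle (quotMk_eq_zero.mp h)) hv
  · rintro rfl
    refine ⟨idealMU_le_idealJ hM, ?_⟩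
    ext q
    obtain ⟨w, rfl⟩ := quotMk_surjective _ q
    constructor
    · rintro ⟨v, hv, hvw⟩
      rw [← hvw]
      exact LieHom.mem_ker.mpr ((mem_idealJ_iff_beta hM).mp hv)
    · intro h
      exact Submodule.mem_map_of_mem ((mem_idealJ_iff_beta hM).mpr (LieHom.mem_ker.mp h))

/-- `MU(L) = M + M𝔪`, because `x u = ε(u) x + x (u - ε(u))`. -/
theorem theta_surjective {ε : UEA F L →ₐ[F] F} (hε : ∀ u, u ∈ 𝔪 ↔ ε u = 0) :
    Function.Surjective (ITilde.theta M 𝔪) := by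
  intro q
  obtain ⟨⟨a, ha⟩, rfl⟩ := Submodule.mkQ_surjective (mulLieIn M 𝔪).toSubmodule q
  have key : ∃ x : M, UniversalEnvelopingAlgebra.ι F (x : L) - a ∈ mulSpan M 𝔪 := by
    refine mulSpan_induction ?_ ?_ ha
    · intro x hx u _
      refine ⟨ε u • ⟨x, hx⟩, ?_⟩
      have e : UniversalEnvelopingAlgebra.ι F (ε u • x) - UniversalEnvelopingAlgebra.ι F x * u =
          UniversalEnvelopingAlgebra.ι F x * (algebraMap F _ (ε u) - u) := by
        rw [mul_sub, map_smul, ← Algebra.commutes, ← Algebra.smul_def]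
      rw [Submodule.coe_smul, e]
      exact ι_mul_mem_mulSpan hx ((hε _).mpr (by simp))
    · rintro v w ⟨x, hx⟩ ⟨y, hy⟩
      refine ⟨x + y, ?_⟩
      rw [Submodule.coe_add, map_add, add_sub_add_comm]
      exact add_mem hx hy
  obtain ⟨x, hx⟩ := key
  exact ⟨x, (Submodule.Quotient.eq (mulLieIn M 𝔪).toSubmodule).mpr hx⟩

theorem betaTilde_injective (hM : (idealMU M).toSubmodule ≤ 𝔪.restrictScalars F) :
    Function.Injective (betaTilde M 𝔪 hM) := by
  rw [injective_iff_map_eq_zero]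
  intro q hq
  obtain ⟨w, rfl⟩ := quotMk_surjective _ q
  exact quotMk_eq_zero.mpr ((mem_idealJ_iff_beta hM).mpr hq)

/-- `U(L) / 𝔍` is the direct sum of `K̃` and `F`, since `J` contains `1`. -/
theorem nonempty_quotient_frakJ_equiv (hM : (idealMU M).toSubmodule ≤ 𝔪.restrictScalars F)
    {ε : UEA F L →ₐ[F] F} (hε : ∀ u, u ∈ 𝔪 ↔ ε u = 0) :
    Nonempty ((UEA F L ⧸ frakJ M 𝔪 hM) ≃ₗ[F] KTilde M 𝔪 hM × F) := by
  let f : UEA F L →ₗ[F] KTilde M 𝔪 hM × F :=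
    (quotMk (idealJ M 𝔪 hM)).toLinearMap.prod ε.toLinearMap
  have hf : Function.Surjective f := by
    rintro ⟨q, c⟩
    obtain ⟨w, rfl⟩ := quotMk_surjective _ q
    refine ⟨w + (c - ε w) • 1, Prod.ext ?_ ?_⟩
    · change quotMk (idealJ M 𝔪 hM) (w + (c - ε w) • 1) = quotMk (idealJ M 𝔪 hM) w
      rw [map_add, map_smul, quotMk_eq_zero.mpr (one_mem_idealJ hM), smul_zero, add_zero]
    · change ε (w + (c - ε w) • 1) = c
      rw [map_add, map_smul, map_one, smul_eq_mul, mul_one, add_sub_cancel]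
  have hker : frakJ M 𝔪 hM = LinearMap.ker f := by
    ext w
    rw [LinearMap.mem_ker]
    change w ∈ idealJ M 𝔪 hM ∧ w ∈ 𝔪 ↔ (quotMk (idealJ M 𝔪 hM) w, ε w) = 0
    rw [Prod.mk_eq_zero, quotMk_eq_zero, hε]
  exact ⟨(Submodule.quotEquivOfEq _ _ hker).trans (f.quotKerEquivOfSurjective hf)⟩

theorem rank_idealJ_quotient_frakJ (hM : (idealMU M).toSubmodule ≤ 𝔪.restrictScalars F)
    {ε : UEA F L →ₐ[F] F} (hε : ∀ u, u ∈ 𝔪 ↔ ε u = 0) :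
    Module.rank F ((idealJ M 𝔪 hM).toSubmodule ⧸
      (frakJ M 𝔪 hM).submoduleOf (idealJ M 𝔪 hM).toSubmodule) = 1 := by
  let f : (idealJ M 𝔪 hM).toSubmodule →ₗ[F] F :=
    ε.toLinearMap ∘ₗ (idealJ M 𝔪 hM).toSubmodule.subtype
  have hf : Function.Surjective f := fun c =>
    ⟨c • ⟨1, one_mem_idealJ hM⟩, by
      change ε (c • 1) = c
      rw [map_smul, map_one, smul_eq_mul, mul_one]⟩
  have hker : (frakJ M 𝔪 hM).submoduleOf (idealJ M 𝔪 hM).toSubmodule = LinearMap.ker f := by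
    ext w
    rw [LinearMap.mem_ker]
    change (w : UEA F L) ∈ idealJ M 𝔪 hM ∧ (w : UEA F L) ∈ 𝔪 ↔ ε w = 0
    rw [hε]
    exact and_iff_right w.2
  have := ((Submodule.quotEquivOfEq _ _ hker).trans
    (f.quotKerEquivOfSurjective hf)).lift_rank_eq
  rw [Module.rank_self, Cardinal.lift_one, Cardinal.lift_eq_one] at this
  exact this

theorem finiteDimensional_ITilde [FiniteDimensional F L] {ε : UEA F L →ₐ[F] F}
    (hε : ∀ u, u ∈ 𝔪 ↔ ε u = 0) : FiniteDimensional F (ITilde M 𝔪) :=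
  Module.Finite.of_surjective _ (theta_surjective (M := M) hε)

theorem finiteDimensional_KTilde [FiniteDimensional F L]
    (hM : (idealMU M).toSubmodule ≤ 𝔪.restrictScalars F) {ε : UEA F L →ₐ[F] F}
    (hε : ∀ u, u ∈ 𝔪 ↔ ε u = 0) : FiniteDimensional F (KTilde M 𝔪 hM) :=
  have := finiteDimensional_ITilde (M := M) hε
  Module.Finite.of_injective (betaTilde M 𝔪 hM).toLinearMap (betaTilde_injective hM)

/-! ### Metabelianity -/

/-- `⁅·, z⁆` is a derivation of the associative algebra `U(L)`, so its values on generators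
decide whether it maps into the two-sided ideal `MU(L)`. -/
theorem lie_mem_idealMU_of_forall_ι {z : UEA F L}
    (h : ∀ x : L, ⁅UniversalEnvelopingAlgebra.ι F x, z⁆ ∈ idealMU M) (u : UEA F L) :
    ⁅u, z⁆ ∈ idealMU M := by
  have hu : u ∈ Algebra.adjoin F (Set.range (UniversalEnvelopingAlgebra.ι F : L → UEA F L)) := by
    rw [adjoin_range_ι]; trivial
  induction hu using Algebra.adjoin_induction with
  | mem u hu => obtain ⟨x, rfl⟩ := hu; exact h x
  | algebraMap r =>
    rw [LieRing.of_associative_ring_bracket, Algebra.commutes, sub_self]; exact zero_mem _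
  | add u v _ _ hu hv => rw [add_lie]; exact add_mem hu hv
  | mul u v _ _ hu hv =>
    have e : ⁅u * v, z⁆ = u * ⁅v, z⁆ + ⁅u, z⁆ * v := by
      simp only [LieRing.of_associative_ring_bracket]; noncomm_ring
    rw [e]
    exact add_mem (mul_mem_mulSpan_left M ⊤ u hv) (mul_mem_mulSpan_right M ⊤ v hu)

theorem lie_mem_idealMU (h : IsLieAbelian (L ⧸ M)) (u v : UEA F L) : ⁅u, v⁆ ∈ idealMU M := by
  refine lie_mem_idealMU_of_forall_ι (fun x => ?_) u
  rw [← lie_skew, neg_mem_iff]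
  refine lie_mem_idealMU_of_forall_ι (fun y => ?_) v
  rw [← LieHom.map_lie]
  exact ι_mem_mulSpan_top (quotMk_eq_zero.mp (by rw [LieHom.map_lie, trivial_lie_zero]))

theorem derivedSeries_LTilde_eq_bot (hM : (idealMU M).toSubmodule ≤ 𝔪.restrictScalars F)
    (h : IsLieAbelian (L ⧸ M)) : LieAlgebra.derivedSeries F (LTilde M 𝔪 hM) 2 = ⊥ := by
  have h1 : LieAlgebra.derivedSeries F (LTilde M 𝔪 hM) 1 ≤
      (LieAlgebra.SemiDirectSum.projr (derOfEnd.comp (betaTilde M 𝔪 hM))).ker := by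
    rw [LieAlgebra.derivedSeries_def, LieAlgebra.derivedSeriesOfIdeal_succ,
      LieAlgebra.derivedSeriesOfIdeal_zero, LieSubmodule.lie_le_iff]
    intro x _ y _
    rw [LieHom.mem_ker, LieHom.map_lie]
    obtain ⟨u, hu⟩ := quotMk_surjective _ x.right
    obtain ⟨v, hv⟩ := quotMk_surjective _ y.right
    change ⁅x.right, y.right⁆ = 0
    rw [← hu, ← hv, ← LieHom.map_lie, quotMk_eq_zero]
    exact idealMU_le_idealJ hM (lie_mem_idealMU h u v)
  rw [LieAlgebra.derivedSeries_def, LieAlgebra.derivedSeriesOfIdeal_succ, eq_bot_iff,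
    LieSubmodule.lie_le_iff]
  intro x hx y hy
  have hx : x.right = 0 := LieHom.mem_ker.mp (h1 hx)
  have hy : y.right = 0 := LieHom.mem_ker.mp (h1 hy)
  rw [LieSubmodule.mem_bot, LieAlgebra.SemiDirectSum.lie_eq_mk, hx, hy, map_zero, trivial_lie_zero,
    lie_zero]
  simp

/-! ### The centralizer of `M` and the augmentation ideal -/

/-- If `x` centralizes `M`, then `⁅x, y u⁆ = y ⁅x, u⁆` for `y ∈ M`, and commutators lie in `𝔪`. -/
theorem ι_mem_idealJ_of_mem_centralizerIdeal
    (hM : (idealMU M).toSubmodule ≤ 𝔪.restrictScalars F) {ε : UEA F L →ₐ[F] F}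
    (hε : ∀ u, u ∈ 𝔪 ↔ ε u = 0) {x : L} (hx : x ∈ centralizerIdeal M) :
    UniversalEnvelopingAlgebra.ι F x ∈ idealJ M 𝔪 hM := by
  rw [mem_idealJ_iff]
  intro a ha
  refine mulSpan_induction (fun y hy u _ => ?_) (fun v w hv hw => ?_) ha
  · have hxy : UniversalEnvelopingAlgebra.ι F x * UniversalEnvelopingAlgebra.ι F y =
        UniversalEnvelopingAlgebra.ι F y * UniversalEnvelopingAlgebra.ι F x := by
      rw [← sub_eq_zero, ← LieRing.of_associative_ring_bracket, ← LieHom.map_lie, hx y hy, map_zero]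
    rw [← mul_assoc, hxy, mul_assoc, mul_assoc, ← mul_sub]
    exact ι_mul_mem_mulSpan hy ((hε _).mpr (by rw [map_sub, map_mul, map_mul, mul_comm, sub_self]))
  · rw [mul_add, add_mul, add_sub_add_comm]; exact add_mem hv hw

theorem mem_augIdeal {u : UEA F L} :
    u ∈ augIdeal F L ↔ UniversalEnvelopingAlgebra.lift F (0 : L →ₗ⁅F⁆ F) u = 0 :=
  Iff.rfl

theorem ι_mem_augIdeal (x : L) : UniversalEnvelopingAlgebra.ι F x ∈ augIdeal F L := by
  rw [mem_augIdeal, UniversalEnvelopingAlgebra.lift_ι_apply, LieHom.zero_apply]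

/-- `M ∩ M ω(L) = 0`: a linear map `Φ : U(L) → M` with `Φ (y u) = ε(u) y` for `y ∈ M` is the identity
on `M` and vanishes on `M ω(L)`. -/
theorem eq_zero_of_ι_mem_mulSpan_augIdeal [FiniteDimensional F L] [IsLieAbelian M] {x : L}
    (hxM : x ∈ M) (hx : UniversalEnvelopingAlgebra.ι F x ∈ mulSpan M (augIdeal F L)) : x = 0 := by
  obtain ⟨Φ, hΦ⟩ := exists_linearMap_mul_eq_augmentation_smul M
  have h0 : Φ (UniversalEnvelopingAlgebra.ι F x) = 0 := by
    refine mulSpan_induction (fun y hy u hu => ?_) (fun v w hv hw => ?_) hx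
    · rw [hΦ ⟨y, hy⟩ u, mem_augIdeal.mp hu, zero_smul]
    · rw [map_add, hv, hw, add_zero]
  have h1 := hΦ ⟨x, hxM⟩ 1
  rw [mul_one, map_one, one_smul] at h1
  exact congrArg Subtype.val (h1.symm.trans h0)

theorem theta_injective [FiniteDimensional F L] [IsLieAbelian M] (h𝔪 : 𝔪 = augIdeal F L) :
    Function.Injective (ITilde.theta M 𝔪) := by
  rw [injective_iff_map_eq_zero]
  intro x hx
  have : UniversalEnvelopingAlgebra.ι F (x : L) ∈ mulSpan M 𝔪 :=
    (Submodule.Quotient.mk_eq_zero (mulLieIn M 𝔪).toSubmodule).mp hx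
  rw [h𝔪] at this
  exact Subtype.ext (eq_zero_of_ι_mem_mulSpan_augIdeal x.2 this)

theorem ι_mem_idealJ_iff [FiniteDimensional F L] [IsLieAbelian M]
    (hM : (idealMU M).toSubmodule ≤ 𝔪.restrictScalars F) (h𝔪 : 𝔪 = augIdeal F L) (x : L) :
    UniversalEnvelopingAlgebra.ι F x ∈ idealJ M 𝔪 hM ↔ x ∈ centralizerIdeal M := by
  refine ⟨fun hx a ha => ?_, ι_mem_idealJ_of_mem_centralizerIdeal hM
    (fun u => by rw [h𝔪]; exact mem_augIdeal)⟩
  have := (mem_idealJ_iff hM).mp hx _ (ι_mem_mulSpan_top ha)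
  rw [← LieRing.of_associative_ring_bracket, ← LieHom.map_lie, h𝔪] at this
  exact eq_zero_of_ι_mem_mulSpan_augIdeal (LieSubmodule.lie_mem M ha) this

theorem mulSpan_centralizerIdeal_le_frakJ [FiniteDimensional F L] [IsLieAbelian M]
    (hM : (idealMU M).toSubmodule ≤ 𝔪.restrictScalars F) (h𝔪 : 𝔪 = augIdeal F L) :
    mulSpan (centralizerIdeal M) ⊤ ≤ frakJ M 𝔪 hM := by
  intro v hv
  refine mulSpan_induction (fun x hx u _ => ?_) (fun v w => add_mem) hv
  refine (mul_mem_frakJ hM u ⟨(ι_mem_idealJ_iff hM h𝔪 x).mpr hx, ?_⟩).2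
  change UniversalEnvelopingAlgebra.ι F x ∈ 𝔪
  rw [h𝔪]
  exact ι_mem_augIdeal x

/-- The homomorphism `L / C_L(M) → K̃` induced by the embedding of `L` into `U(L)`. -/
def centralizerQuotMap (hM : (idealMU M).toSubmodule ≤ 𝔪.restrictScalars F)
    (h : ∀ x ∈ centralizerIdeal M, UniversalEnvelopingAlgebra.ι F x ∈ idealJ M 𝔪 hM) :
    (L ⧸ centralizerIdeal M) →ₗ⁅F⁆ KTilde M 𝔪 hM :=
  quotLift (centralizerIdeal M)
    ((quotMk (idealJ M 𝔪 hM)).comp (UniversalEnvelopingAlgebra.ι F : L →ₗ⁅F⁆ UEA F L))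
    fun x hx => LieHom.mem_ker.mpr (quotMk_eq_zero.mpr (h x hx))

theorem betaTilde_centralizerQuotMap_theta (hM : (idealMU M).toSubmodule ≤ 𝔪.restrictScalars F)
    (h : ∀ x ∈ centralizerIdeal M, UniversalEnvelopingAlgebra.ι F x ∈ idealJ M 𝔪 hM)
    (q : L ⧸ centralizerIdeal M) (a : M) :
    betaTilde M 𝔪 hM (centralizerQuotMap hM h q) (ITilde.theta M 𝔪 a) =
      ITilde.theta M 𝔪 (adQuot M q a) := by
  obtain ⟨x, rfl⟩ := quotMk_surjective _ q
  refine congrArg (ITilde.mk M 𝔪) (Subtype.ext ?_)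
  exact (LieHom.map_lie (UniversalEnvelopingAlgebra.ι F) x (a : L)).symm

/-- The homomorphism `χ̃ : M ⋊ L / C_L(M) → L̃`. -/
def chiTilde [IsLieAbelian M] (hM : (idealMU M).toSubmodule ≤ 𝔪.restrictScalars F)
    (h : ∀ x ∈ centralizerIdeal M, UniversalEnvelopingAlgebra.ι F x ∈ idealJ M 𝔪 hM) :
    semiQuot M →ₗ⁅F⁆ LTilde M 𝔪 hM where
  toFun s := ⟨ITilde.theta M 𝔪 s.left, centralizerQuotMap hM h s.right⟩
  map_add' s t := LieAlgebra.SemiDirectSum.ext (map_add _ _ _) (map_add _ _ _)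
  map_smul' c s := LieAlgebra.SemiDirectSum.ext (map_smul _ _ _) (map_smul _ _ _)
  map_lie' {s t} := by
    refine LieAlgebra.SemiDirectSum.ext ?_ (LieHom.map_lie _ _ _)
    change ITilde.theta M 𝔪 (⁅s.left, t.left⁆ + adQuot M s.right t.left -
        adQuot M t.right s.left) =
      0 + betaTilde M 𝔪 hM (centralizerQuotMap hM h s.right) (ITilde.theta M 𝔪 t.left) -
        betaTilde M 𝔪 hM (centralizerQuotMap hM h t.right) (ITilde.theta M 𝔪 s.left)
    rw [betaTilde_centralizerQuotMap_theta, betaTilde_centralizerQuotMap_theta,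
      trivial_lie_zero, map_sub, map_add, map_zero]

theorem centralizerQuotMap_injective [FiniteDimensional F L] [IsLieAbelian M]
    (hM : (idealMU M).toSubmodule ≤ 𝔪.restrictScalars F) (h𝔪 : 𝔪 = augIdeal F L)
    (h : ∀ x ∈ centralizerIdeal M, UniversalEnvelopingAlgebra.ι F x ∈ idealJ M 𝔪 hM) :
    Function.Injective (centralizerQuotMap hM h) := by
  rw [injective_iff_map_eq_zero]
  intro q hq
  obtain ⟨x, rfl⟩ := quotMk_surjective _ q
  exact quotMk_eq_zero.mpr ((ι_mem_idealJ_iff hM h𝔪 x).mp (quotMk_eq_zero.mp hq))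

theorem chiTilde_injective [FiniteDimensional F L] [IsLieAbelian M]
    (hM : (idealMU M).toSubmodule ≤ 𝔪.restrictScalars F) (h𝔪 : 𝔪 = augIdeal F L)
    (h : ∀ x ∈ centralizerIdeal M, UniversalEnvelopingAlgebra.ι F x ∈ idealJ M 𝔪 hM) :
    Function.Injective (chiTilde hM h) := fun _ _ hst =>
  LieAlgebra.SemiDirectSum.ext
    (theta_injective h𝔪 (congrArg LieAlgebra.SemiDirectSum.left hst))
    (centralizerQuotMap_injective hM h𝔪 h (congrArg LieAlgebra.SemiDirectSum.right hst))

theorem chiTilde_bijective_iff [FiniteDimensional F L] [IsLieAbelian M]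
    (hM : (idealMU M).toSubmodule ≤ 𝔪.restrictScalars F) (h𝔪 : 𝔪 = augIdeal F L)
    (h : ∀ x ∈ centralizerIdeal M, UniversalEnvelopingAlgebra.ι F x ∈ idealJ M 𝔪 hM) :
    Function.Bijective (chiTilde hM h) ↔
      Module.finrank F (L ⧸ centralizerIdeal M) = Module.finrank F (KTilde M 𝔪 hM) := by
  have hε : ∀ u, u ∈ 𝔪 ↔ UniversalEnvelopingAlgebra.lift F (0 : L →ₗ⁅F⁆ F) u = 0 := fun u => by
    rw [h𝔪]; exact mem_augIdeal
  have := finiteDimensional_KTilde hM hε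
  have hinj := centralizerQuotMap_injective hM h𝔪 h
  constructor
  · rintro ⟨-, hsurj⟩
    refine (LinearEquiv.ofBijective (centralizerQuotMap hM h).toLinearMap
      ⟨hinj, fun q => ?_⟩).finrank_eq
    obtain ⟨s, hs⟩ := hsurj ⟨0, q⟩
    exact ⟨s.right, congrArg LieAlgebra.SemiDirectSum.right hs⟩
  · intro hdim
    have hsurj : Function.Surjective (centralizerQuotMap hM h) :=
      (LinearMap.injective_iff_surjective_of_finrank_eq_finrank
        (f := (centralizerQuotMap hM h).toLinearMap) hdim).mp hinj
    refine ⟨chiTilde_injective hM h𝔪 h, fun t => ?_⟩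
    obtain ⟨a, ha⟩ := theta_surjective (M := M) hε t.left
    obtain ⟨q, hq⟩ := hsurj t.right
    exact ⟨⟨a, q⟩, LieAlgebra.SemiDirectSum.ext ha hq⟩

end CodimensionOne

theorem mainTheorem6 {F L : Type*} [Field F] [LieRing L] [LieAlgebra F L] [FiniteDimensional F L]
    (M : LieIdeal F L) [IsLieAbelian M]
    (𝔪 : Ideal (UEA F L)) [𝔪.IsTwoSided]
    (hcodim : Nonempty ((UEA F L ⧸ 𝔪) ≃ₐ[F] F))
    (hM : (idealMU M).toSubmodule ≤ 𝔪.restrictScalars F) :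
    -- (1)
    ((∃! β : (UEA F L ⧸ idealMU M) →ₗ⁅F⁆ Module.End F (ITilde M 𝔪),
        ∀ (w : UEA F L) (a : idealMU M),
          β (quotMk (idealMU M) w) (ITilde.mk M 𝔪 a) = ITilde.mk M 𝔪 ⁅w, a⁆) ∧
      ∀ (w : UEA F L) (a : idealMU M),
        beta M 𝔪 hM (quotMk (idealMU M) w) (ITilde.mk M 𝔪 a) = ITilde.mk M 𝔪 ⁅w, a⁆) ∧
    -- (2)
    ((∀ J : LieIdeal F (UEA F L),
        (idealMU M ≤ J ∧
          J.toSubmodule.map (quotMk (idealMU M)).toLinearMap = (beta M 𝔪 hM).ker.toSubmodule) ↔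
        J = idealJ M 𝔪 hM) ∧
      FiniteDimensional F (LTilde M 𝔪 hM) ∧
      (IsLieAbelian (L ⧸ M) → LieAlgebra.derivedSeries F (LTilde M 𝔪 hM) 2 = ⊥)) ∧
    -- (3)
    ((∀ u : UEA F L, ∀ w ∈ frakJ M 𝔪 hM,
        u * w ∈ frakJ M 𝔪 hM ∧ w * u ∈ frakJ M 𝔪 hM) ∧
      Module.rank F ((idealJ M 𝔪 hM).toSubmodule ⧸
        (frakJ M 𝔪 hM).submoduleOf (idealJ M 𝔪 hM).toSubmodule) = 1 ∧
      FiniteDimensional F (UEA F L ⧸ frakJ M 𝔪 hM) ∧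
      Module.finrank F (UEA F L ⧸ frakJ M 𝔪 hM) = Module.finrank F (KTilde M 𝔪 hM) + 1) ∧
    -- (4)
    (𝔪 = augIdeal F L →
      (∀ x : L, UniversalEnvelopingAlgebra.ι F x ∈ idealJ M 𝔪 hM ↔ x ∈ centralizerIdeal M) ∧
      mulSpan (centralizerIdeal M) ⊤ ≤ frakJ M 𝔪 hM) ∧
    -- (5)
    (𝔪 = augIdeal F L →
      ∃ χ : semiQuot M →ₗ⁅F⁆ LTilde M 𝔪 hM,
        (∀ (a : M) (x : L),
          χ ⟨a, quotMk (centralizerIdeal M) x⟩ =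
            ⟨ITilde.theta M 𝔪 a, quotMk (idealJ M 𝔪 hM) (UniversalEnvelopingAlgebra.ι F x)⟩) ∧
        Function.Injective χ ∧
        (Function.Bijective χ ↔
          Module.finrank F (L ⧸ centralizerIdeal M) = Module.finrank F (KTilde M 𝔪 hM))) := by
  obtain ⟨ε, hε⟩ := exists_algHom_ker_eq hcodim
  have := finiteDimensional_ITilde (M := M) hε
  have := finiteDimensional_KTilde hM hε
  obtain ⟨e⟩ := nonempty_quotient_frakJ_equiv hM hε
  refine ⟨⟨⟨beta M 𝔪 hM, beta_mk hM, fun β hβ => ?_⟩, beta_mk hM⟩,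
    ⟨eq_idealJ_iff hM, ?_, derivedSeries_LTilde_eq_bot hM⟩,
    ⟨fun u w hw => mul_mem_frakJ hM u hw, rank_idealJ_quotient_frakJ hM hε, ?_, ?_⟩,
    fun h𝔪 => ⟨ι_mem_idealJ_iff hM h𝔪, mulSpan_centralizerIdeal_le_frakJ hM h𝔪⟩,
    fun h𝔪 => ?_⟩
  · ext q : 1
    obtain ⟨w, rfl⟩ := quotMk_surjective _ q
    refine LinearMap.ext fun y => ?_
    obtain ⟨a, rfl⟩ := Submodule.mkQ_surjective (mulLieIn M 𝔪).toSubmodule y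
    exact hβ w a
  · exact Module.Finite.equiv (LieAlgebra.SemiDirectSum.toProdl _).symm
  · exact Module.Finite.equiv e.symm
  · rw [e.finrank_eq, Module.finrank_prod, Module.finrank_self]
  · have h := fun x => (ι_mem_idealJ_iff hM h𝔪 x).mpr
    exact ⟨chiTilde hM h, fun a x => rfl, chiTilde_injective hM h𝔪 h,
      chiTilde_bijective_iff hM h𝔪 h⟩
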